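/- Let $d\in\mathbb{N}$ and let $1<p<\infty$. For $x\in\mathbb{R}^d$ write $x^2=x_1^2+\cdots+x_d^2$, $|x|=\sqrt{x^2}$, and for $z\in\mathbb{C}^d$ write $z^2=z_1^2+\cdots+z_d^2$. Let $\rho(x)=(2\pi)^{-d/2}e^{-x^2/2}$, and let $L^p(\mathbb{R}^d,\rho)$ be the space of complex-valued functions that are $L^p$ with respect to the Gaussian measure $\rho(x)\,dx$. For $f\in L^p(\mathbb{R}^d,\rho)$ the Segal--Bargmann transform of $f$ is $$Sf(z)=(2\pi)^{-d/2}\int_{\mathbb{R}^d}e^{-(z-x)^2/2}f(x)\,dx,\qquad z\in\mathbb{C}^d.$$ Suppose that $F$ is a holomorphic function on $\mathbb{C}^d$. Then the following two conditions are equivalent. 1. For every $n\in\mathbb{N}$ there exists a constant $C_n$ such that for all $x,y\in\mathbb{R}^d$ $$|F(x+iy)|\le C_n\,e^{y^2/2}\,e^{x^2/(2(p-1))}\,\frac{1}{(1+|x|)^n(1+|y|)^n}.$$ 2. There exists $f\in L^p(\mathbb{R}^d,\rho)$ such that $Sf=F$, where $f$ is smooth ($C^\infty$) and has the property that for all multi-indices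 $\alpha,\beta$ $$x^\alpha\left(\frac{\partial}{\partial x}\right)^{\beta}f(x)\in L^p(\mathbb{R}^d,\rho).$$ -/

import Mathlib

open MeasureTheory
open scoped ContDiff

noncomputable section

namespace SegalBargmann

/-- The standard Gaussian density `ρ(x) = (2π)^{-d/2} e^{-x²/2}` on `ℝ^d`. -/
def rho (d : ℕ) (x : EuclideanSpace ℝ (Fin d)) : ℝ :=
  (2 * Real.pi) ^ (-(d : ℝ) / 2) * Real.exp (-(∑ j, x j ^ 2) / 2)

/-- The entire analytic continuation of `ρ` to `ℂ^d`; here `z² = z₁² + ⋯ + z_d²`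
(no complex conjugation). -/
def rhoC (d : ℕ) (z : EuclideanSpace ℂ (Fin d)) : ℂ :=
  (((2 * Real.pi) ^ (-(d : ℝ) / 2) : ℝ) : ℂ) * Complex.exp (-(∑ j, z j ^ 2) / 2)

/-- The Gaussian measure `ρ(x) dx` on `ℝ^d`. -/
def gaussianMeasure (d : ℕ) : Measure (EuclideanSpace ℝ (Fin d)) :=
  volume.withDensity fun x => ENNReal.ofReal (rho d x)

/-- The point `x + iy` of `ℂ^d`, for `x, y ∈ ℝ^d`. -/
def complexPoint {d : ℕ} (x y : EuclideanSpace ℝ (Fin d)) : EuclideanSpace ℂ (Fin d) :=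
  WithLp.toLp 2 fun j => (x j : ℂ) + Complex.I * (y j : ℂ)

/-- The Segal-Bargmann transform `Sf(z) = ∫ ρ(z - x) f(x) dx`, `z ∈ ℂ^d`. -/
def transform {d : ℕ} (f : EuclideanSpace ℝ (Fin d) → ℂ) (z : EuclideanSpace ℂ (Fin d)) : ℂ :=
  ∫ x : EuclideanSpace ℝ (Fin d), rhoC d (z - complexPoint x 0) * f x

/-- The monomial `x^α`, for a multi-index `α`. -/
def monomial {d : ℕ} (α : Fin d → ℕ) (x : EuclideanSpace ℝ (Fin d)) : ℝ :=
  ∏ j, x j ^ α j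

/-- The partial derivative `∂f/∂x_k`. -/
def partialDeriv {d : ℕ} (k : Fin d) (f : EuclideanSpace ℝ (Fin d) → ℂ) :
    EuclideanSpace ℝ (Fin d) → ℂ :=
  fun x => lineDeriv ℝ f x (EuclideanSpace.single k 1)

/-- The derivative `(∂/∂x)^β f = (∂/∂x₁)^{β₁} ⋯ (∂/∂x_d)^{β_d} f`, for a multi-index `β`. -/
def multiDeriv {d : ℕ} (β : Fin d → ℕ) (f : EuclideanSpace ℝ (Fin d) → ℂ) :
    EuclideanSpace ℝ (Fin d) → ℂ :=
  (List.finRange d).foldr (fun k g => (partialDeriv k)^[β k] g) f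

end SegalBargmann

end

/-!
The inverse kernel is `e^{(z-x)²/2}`, which up to a constant is `ρ(z - x)⁻¹`. On a slice `u + iℝ^d`
it is a Gaussian times a character, so `f(x) = (2π)^{-d/2} ∫ e^{(u+iv-x)²/2} F(u + iv) dv` is
essentially the Fourier transform of the slice, and Fourier inversion gives `Sf = F`. By Cauchy's
theorem `f` does not depend on `u`. Estimating `f(x)` on the slice through `u = ((p-1)/p) x`
balances `e^{(x-u)²/2}` against the growth `e^{u²/(2(p-1))}` of `F`: the product is `e^{x²/(2p)}`,
exactly the borderline for `L^p(ρ)`, and the rapidly decreasing factors survive.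

The transform turns the creation operator `x_k - ∂/∂x_k` into multiplication by `z_k`. Applied to
the inversion formula, this bounds all derivatives of `f`. Applied to `Sf`, it shows that the
transforms in question are closed under multiplication by the coordinates, so the bound
`|Sf(x + iy)| ≤ C e^{y²/2} e^{x²/(2(p-1))}` coming from Hölder's inequality self-improves by
arbitrary powers of `1 + ∑ |z_k|`.
-/

open Asymptotics Filter Metric
open scoped ENNReal FourierTransform Topology

noncomputable section

namespace SegalBargmann

variable {d : ℕ} {f g : EuclideanSpace ℝ (Fin d) → ℂ} {G : EuclideanSpace ℂ (Fin d) → ℂ}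

/-! ### Multi-index derivatives -/

theorem single_one_le {ι : Type*} [DecidableEq ι] {β : ι → ℕ} {k : ι} (hk : β k ≠ 0) :
    Pi.single k 1 ≤ β :=
  update_le_iff.2 ⟨Nat.one_le_iff_ne_zero.2 hk, fun _ _ => Nat.zero_le _⟩

theorem multiIndex_induction {ι : Type*} [Finite ι] [DecidableEq ι] {P : (ι → ℕ) → Prop}
    (zero : P 0) (add_single : ∀ β k, (∀ γ ≤ β, P γ) → P (β + Pi.single k 1)) (β : ι → ℕ) :
    P β := by
  induction β using WellFoundedLT.induction with
  | ind β ih =>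
    by_cases hβ : β = 0
    · exact hβ ▸ zero
    obtain ⟨k, hk⟩ := Function.ne_iff.1 hβ
    have hlt : β - Pi.single k 1 < β :=
      Pi.lt_def.2 ⟨tsub_le_self, k, by simpa using Nat.sub_lt (Nat.pos_of_ne_zero hk) one_pos⟩
    rw [← tsub_add_cancel_of_le (single_one_le hk)]
    exact add_single _ k fun γ hγ => ih γ (hγ.trans_lt hlt)

theorem partialDeriv_eq_fderiv (hf : Differentiable ℝ f) (k : Fin d) :
    partialDeriv k f = fun x => fderiv ℝ f x (EuclideanSpace.single k 1) :=
  funext fun x => (hf x).lineDeriv_eq_fderiv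

theorem contDiff_partialDeriv (hf : ContDiff ℝ ∞ f) (k : Fin d) :
    ContDiff ℝ ∞ (partialDeriv k f) := by
  rw [partialDeriv_eq_fderiv (hf.differentiable (by simp))]
  exact (hf.fderiv_right (m := ∞) (by simp)).clm_apply contDiff_const

theorem partialDeriv_comm (hf : ContDiff ℝ ∞ f) (j k : Fin d) :
    partialDeriv j (partialDeriv k f) = partialDeriv k (partialDeriv j f) := by
  have hdiff : Differentiable ℝ (fderiv ℝ f) :=
    (hf.fderiv_right (m := ∞) (by simp)).differentiable (by simp)
  have hsecond (i l : Fin d) : partialDeriv i (partialDeriv l f) = fun x =>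
      fderiv ℝ (fderiv ℝ f) x (EuclideanSpace.single i 1) (EuclideanSpace.single l 1) := by
    rw [partialDeriv_eq_fderiv ((contDiff_partialDeriv hf l).differentiable (by simp)),
      partialDeriv_eq_fderiv (hf.differentiable (by simp))]
    funext x
    rw [fderiv_clm_apply (hdiff x) (differentiableAt_const _)]
    simp
  rw [hsecond, hsecond]
  funext x
  exact (hf.contDiffAt.isSymmSndFDerivAt (by
    simpa using WithTop.coe_le_coe.2 (le_top : (2 : ℕ∞) ≤ ⊤))).eq _ _

theorem partialDeriv_add (hf : Differentiable ℝ f) (hg : Differentiable ℝ g) (k : Fin d) :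
    partialDeriv k (fun x => f x + g x) = fun x => partialDeriv k f x + partialDeriv k g x :=
  funext fun x => deriv_fun_add (hf x).lineDifferentiableAt (hg x).lineDifferentiableAt

theorem partialDeriv_sub (hf : Differentiable ℝ f) (hg : Differentiable ℝ g) (k : Fin d) :
    partialDeriv k (fun x => f x - g x) = fun x => partialDeriv k f x - partialDeriv k g x :=
  funext fun x => deriv_fun_sub (hf x).lineDifferentiableAt (hg x).lineDifferentiableAt

theorem partialDeriv_const_mul (c : ℂ) (k : Fin d) (f : EuclideanSpace ℝ (Fin d) → ℂ) :
    partialDeriv k (fun x => c * f x) = fun x => c * partialDeriv k f x :=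
  funext fun _ => deriv_const_mul_field _

theorem contDiff_coord (j : Fin d) :
    ContDiff ℝ ∞ fun x : EuclideanSpace ℝ (Fin d) => (x j : ℂ) :=
  (Complex.ofRealCLM ∘L EuclideanSpace.proj (𝕜 := ℝ) j).contDiff

theorem hasFDerivAt_coord (j : Fin d) (x : EuclideanSpace ℝ (Fin d)) :
    HasFDerivAt (fun x : EuclideanSpace ℝ (Fin d) => (x j : ℂ))
      (Complex.ofRealCLM ∘L EuclideanSpace.proj (𝕜 := ℝ) j) x :=
  (Complex.ofRealCLM ∘L EuclideanSpace.proj (𝕜 := ℝ) j).hasFDerivAt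

theorem partialDeriv_coord_mul (hf : Differentiable ℝ f) (j k : Fin d) :
    partialDeriv k (fun x => (x j : ℂ) * f x) =
      fun x => (x j : ℂ) * partialDeriv k f x + if j = k then f x else 0 := by
  have hmul (x) := (hasFDerivAt_coord j x).fun_mul (hf x).hasFDerivAt
  rw [partialDeriv_eq_fderiv hf, partialDeriv_eq_fderiv fun x => (hmul x).differentiableAt]
  funext x
  rw [(hmul x).fderiv]
  by_cases hjk : j = k <;> simp [hjk]

theorem contDiff_iterate_partialDeriv (hf : ContDiff ℝ ∞ f) (k : Fin d) (n : ℕ) :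
    ContDiff ℝ ∞ ((partialDeriv k)^[n] f) := by
  induction n with
  | zero => exact hf
  | succ n ih =>
    rw [Function.iterate_succ_apply']
    exact contDiff_partialDeriv ih k

theorem partialDeriv_iterate_comm (hf : ContDiff ℝ ∞ f) (j k : Fin d) (n : ℕ) :
    partialDeriv j ((partialDeriv k)^[n] f) = (partialDeriv k)^[n] (partialDeriv j f) := by
  induction n with
  | zero => rfl
  | succ n ih =>
    rw [Function.iterate_succ_apply', Function.iterate_succ_apply', ← ih,
      partialDeriv_comm (contDiff_iterate_partialDeriv hf k n)]

theorem contDiff_foldr_partialDeriv (hf : ContDiff ℝ ∞ f) (β : Fin d → ℕ) (l : List (Fin d)) :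
    ContDiff ℝ ∞ (l.foldr (fun k g => (partialDeriv k)^[β k] g) f) := by
  induction l with
  | nil => exact hf
  | cons a l ih => exact contDiff_iterate_partialDeriv ih a _

theorem partialDeriv_foldr (hf : ContDiff ℝ ∞ f) (β : Fin d → ℕ) {k : Fin d} {l : List (Fin d)}
    (hl : l.Nodup) (hk : k ∈ l) :
    partialDeriv k (l.foldr (fun k g => (partialDeriv k)^[β k] g) f) =
      l.foldr (fun j g => (partialDeriv j)^[(β + Pi.single k 1 : Fin d → ℕ) j] g) f := by
  induction l with
  | nil => simp at hk
  | cons a l ih =>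
    rw [List.nodup_cons] at hl
    simp only [List.foldr_cons]
    by_cases hka : k = a
    · subst hka
      have hcongr : l.foldr (fun j g => (partialDeriv j)^[(β + Pi.single k 1 : Fin d → ℕ) j] g) f =
          l.foldr (fun j g => (partialDeriv j)^[β j] g) f :=
        List.foldr_ext _ _ _ fun j hj _ => by simp [ne_of_mem_of_not_mem hj hl.1]
      rw [hcongr]
      simp [Function.iterate_succ_apply']
    · rw [partialDeriv_iterate_comm (contDiff_foldr_partialDeriv hf β l),
        ih hl.2 ((List.mem_cons.1 hk).resolve_left hka)]
      simp [Ne.symm hka]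

theorem contDiff_multiDeriv (hf : ContDiff ℝ ∞ f) (β : Fin d → ℕ) :
    ContDiff ℝ ∞ (multiDeriv β f) :=
  contDiff_foldr_partialDeriv hf β _

theorem multiDeriv_zero (f : EuclideanSpace ℝ (Fin d) → ℂ) : multiDeriv 0 f = f := by
  unfold multiDeriv
  induction List.finRange d with
  | nil => rfl
  | cons a l => simp

theorem multiDeriv_add_single (hf : ContDiff ℝ ∞ f) (β : Fin d → ℕ) (k : Fin d) :
    multiDeriv (β + Pi.single k 1) f = partialDeriv k (multiDeriv β f) :=
  (partialDeriv_foldr hf β (List.nodup_finRange d) (List.mem_finRange k)).symm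

theorem multiDeriv_partialDeriv (hf : ContDiff ℝ ∞ f) (β : Fin d → ℕ) (k : Fin d) :
    multiDeriv β (partialDeriv k f) = multiDeriv (β + Pi.single k 1) f := by
  induction β using multiIndex_induction with
  | zero => rw [multiDeriv_add_single hf, multiDeriv_zero, multiDeriv_zero]
  | add_single β j ih =>
    rw [multiDeriv_add_single (contDiff_partialDeriv hf k), ih β le_rfl, add_right_comm,
      multiDeriv_add_single hf (β + Pi.single k 1)]

theorem multiDeriv_sub (hf : ContDiff ℝ ∞ f) (hg : ContDiff ℝ ∞ g) (β : Fin d → ℕ) :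
    multiDeriv β (fun x => f x - g x) = fun x => multiDeriv β f x - multiDeriv β g x := by
  induction β using multiIndex_induction with
  | zero => simp only [multiDeriv_zero]
  | add_single β k ih =>
    rw [multiDeriv_add_single (hf.sub hg), ih β le_rfl, multiDeriv_add_single hf,
      multiDeriv_add_single hg,
      partialDeriv_sub ((contDiff_multiDeriv hf β).differentiable (by simp))
        ((contDiff_multiDeriv hg β).differentiable (by simp))]

theorem multiDeriv_coord_mul (hf : ContDiff ℝ ∞ f) (β : Fin d → ℕ) (j : Fin d) :
    multiDeriv β (fun x => (x j : ℂ) * f x) =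
      fun x => (x j : ℂ) * multiDeriv β f x + (β j : ℂ) * multiDeriv (β - Pi.single j 1) f x := by
  induction β using multiIndex_induction with
  | zero => simp [multiDeriv_zero]
  | add_single β k ih =>
    have hdiff (γ : Fin d → ℕ) : Differentiable ℝ (multiDeriv γ f) :=
      (contDiff_multiDeriv hf γ).differentiable (by simp)
    have hcoord : Differentiable ℝ fun x : EuclideanSpace ℝ (Fin d) => (x j : ℂ) :=
      (contDiff_coord j).differentiable (by simp)
    rw [multiDeriv_add_single ((contDiff_coord j).mul hf), ih β le_rfl,
      partialDeriv_add (hcoord.fun_mul (hdiff _)) ((hdiff _).const_mul _),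
      partialDeriv_coord_mul (hdiff _), partialDeriv_const_mul, ← multiDeriv_add_single hf,
      ← multiDeriv_add_single hf]
    funext x
    rw [add_assoc]
    congr 1
    by_cases hjk : j = k
    · subst hjk
      rcases eq_or_ne (β j) 0 with hβ | hβ
      · simp [hβ]
      · simp [tsub_add_cancel_of_le (single_one_le hβ)]
        ring
    · have hswap : β - Pi.single j 1 + Pi.single k 1 = β + Pi.single k 1 - Pi.single j 1 := by
        ext i
        rcases eq_or_ne i j with rfl | hi <;> simp [*]
      simp [hjk, hswap]

theorem monomial_zero (x : EuclideanSpace ℝ (Fin d)) : monomial 0 x = 1 := by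
  simp [monomial]

theorem monomial_add_single (α : Fin d → ℕ) (j : Fin d) (x : EuclideanSpace ℝ (Fin d)) :
    monomial (α + Pi.single j 1) x = monomial α x * x j := by
  simp only [monomial, Pi.add_apply, pow_add, Finset.prod_mul_distrib]
  congr 1
  rw [Finset.prod_eq_single j] <;> simp +contextual

/-! ### Functions of Schwartz type -/

/-- The creation operator `x_k - ∂/∂x_k`, which the Segal-Bargmann transform turns into
multiplication by `z_k`. -/
def creation (k : Fin d) (f : EuclideanSpace ℝ (Fin d) → ℂ) (x : EuclideanSpace ℝ (Fin d)) : ℂ :=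
  (x k : ℂ) * f x - partialDeriv k f x

/-- Smooth functions all of whose derivatives, multiplied by arbitrary monomials, are in
`L^q(μ)`. -/
structure SchwartzLp (q : ℝ≥0∞) (μ : Measure (EuclideanSpace ℝ (Fin d)))
    (f : EuclideanSpace ℝ (Fin d) → ℂ) : Prop where
  contDiff : ContDiff ℝ ∞ f
  memLp_monomial_mul (α β : Fin d → ℕ) :
    MemLp (fun x => (monomial α x : ℂ) * multiDeriv β f x) q μ

namespace SchwartzLp

variable {q : ℝ≥0∞} {μ : Measure (EuclideanSpace ℝ (Fin d))}

theorem memLp (hf : SchwartzLp q μ f) : MemLp f q μ := by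
  simpa only [monomial_zero, multiDeriv_zero, Complex.ofReal_one, one_mul]
    using hf.memLp_monomial_mul 0 0

theorem coord_mul (hf : SchwartzLp q μ f) (k : Fin d) :
    SchwartzLp q μ fun x => (x k : ℂ) * f x where
  contDiff := (contDiff_coord k).mul hf.contDiff
  memLp_monomial_mul α β := by
    convert (hf.memLp_monomial_mul (α + Pi.single k 1) β).add
      ((hf.memLp_monomial_mul α (β - Pi.single k 1)).const_mul (β k : ℂ)) using 1
    funext x
    simp only [multiDeriv_coord_mul hf.contDiff, Pi.add_apply, monomial_add_single]
    push_cast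
    ring

theorem partialDeriv (hf : SchwartzLp q μ f) (k : Fin d) :
    SchwartzLp q μ (partialDeriv k f) where
  contDiff := contDiff_partialDeriv hf.contDiff k
  memLp_monomial_mul α β := by
    simpa only [multiDeriv_partialDeriv hf.contDiff] using
      hf.memLp_monomial_mul α (β + Pi.single k 1)

theorem sub (hf : SchwartzLp q μ f) (hg : SchwartzLp q μ g) :
    SchwartzLp q μ fun x => f x - g x where
  contDiff := hf.contDiff.sub hg.contDiff
  memLp_monomial_mul α β := by
    simp only [multiDeriv_sub hf.contDiff hg.contDiff, mul_sub]
    exact (hf.memLp_monomial_mul α β).sub (hg.memLp_monomial_mul α β)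

theorem creation (hf : SchwartzLp q μ f) (k : Fin d) : SchwartzLp q μ (creation k f) :=
  (hf.coord_mul k).sub (hf.partialDeriv k)

end SchwartzLp

/-! ### Shifting the contour of integration -/

theorem complexPoint_apply (x y : EuclideanSpace ℝ (Fin d)) (j : Fin d) :
    complexPoint x y j = (x j : ℂ) + Complex.I * (y j : ℂ) := rfl

@[fun_prop]
theorem continuous_complexPoint {X : Type*} [TopologicalSpace X]
    {f g : X → EuclideanSpace ℝ (Fin d)} (hf : Continuous f) (hg : Continuous g) :
    Continuous fun t => complexPoint (f t) (g t) := by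
  unfold complexPoint
  fun_prop

theorem exists_complexPoint_eq (z : EuclideanSpace ℂ (Fin d)) :
    ∃ x y : EuclideanSpace ℝ (Fin d), complexPoint x y = z := by
  refine ⟨WithLp.toLp 2 fun j => (z j).re, WithLp.toLp 2 fun j => (z j).im, ?_⟩
  ext j
  simp [complexPoint_apply, mul_comm Complex.I, Complex.re_add_im]

theorem smul_complexPoint_add (c : ℂ) (u v : EuclideanSpace ℝ (Fin d)) :
    c • complexPoint u 0 + complexPoint 0 v = complexPoint (c.re • u) (v + c.im • u) := by
  ext j
  simp only [PiLp.add_apply, PiLp.smul_apply, complexPoint_apply, smul_eq_mul, PiLp.zero_apply]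
  push_cast
  conv_lhs => rw [← Complex.re_add_im c]
  ring

theorem integrable_inv_one_add_norm_pow {E : Type*} [NormedAddCommGroup E] [NormedSpace ℝ E]
    [FiniteDimensional ℝ E] [MeasurableSpace E] [BorelSpace E] {μ : Measure E}
    [μ.IsAddHaarMeasure] {n : ℕ} (hn : Module.finrank ℝ E < n) :
    Integrable (fun v => ((1 + ‖v‖) ^ n)⁻¹) μ := by
  refine (integrable_one_add_norm (r := n) (by exact_mod_cast hn)).congr (.of_forall fun v => ?_)
  simp only [Real.rpow_neg (show 0 ≤ 1 + ‖v‖ by positivity), Real.rpow_natCast]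

theorem inv_one_add_norm_add_pow_le {E : Type*} [SeminormedAddCommGroup E] {a b : E} {R : ℝ}
    (hb : ‖b‖ ≤ R) (n : ℕ) :
    ((1 + ‖a + b‖) ^ n)⁻¹ ≤ (1 + R) ^ n * ((1 + ‖a‖) ^ n)⁻¹ := by
  have hR : 0 ≤ R := (norm_nonneg b).trans hb
  have ha : ‖a‖ ≤ ‖a + b‖ + ‖b‖ := by simpa using norm_sub_le (a + b) b
  rw [← div_eq_mul_inv, le_div_iff₀ (by positivity), inv_mul_le_iff₀ (by positivity), ← mul_pow]
  gcongr
  nlinarith [norm_nonneg (a + b)]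

theorem differentiable_integral_of_locally_dominated {α E : Type*} [MeasurableSpace α]
    {μ : Measure α} [NormedAddCommGroup E] [NormedSpace ℂ E] [CompleteSpace E] {K : ℂ → α → E}
    (hmeas : ∀ c, AEStronglyMeasurable (K c) μ) (hdiff : ∀ a, Differentiable ℂ fun c => K c a)
    {bound : ℝ → α → ℝ} (hint : ∀ R, Integrable (bound R) μ)
    (hbound : ∀ R c a, ‖c‖ ≤ R → ‖K c a‖ ≤ bound R a) :
    Differentiable ℂ fun c => ∫ a, K c a ∂μ := by
  intro c₀
  have hmeas_deriv : AEStronglyMeasurable (fun a => deriv (fun c => K c a) c₀) μ :=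
    aestronglyMeasurable_of_tendsto_ae (𝓝[≠] c₀)
      (f := fun c a => slope (fun c => K c a) c₀ c)
      (fun c => ((hmeas c).sub (hmeas c₀)).const_smul ((c - c₀)⁻¹))
      (.of_forall fun a => (hdiff a c₀).hasDerivAt.tendsto_slope)
  have hderiv_le (a : α) (c : ℂ) (hc : c ∈ ball c₀ 1) :
      ‖deriv (fun c => K c a) c‖ ≤ bound (‖c₀‖ + 2) a := by
    have := Complex.norm_deriv_le_of_forall_mem_sphere_norm_le (c := c) one_pos
      (hdiff a).diffContOnCl (C := bound (‖c₀‖ + 2) a) fun w hw => hbound _ w a ?_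
    · simpa using this
    · rw [mem_sphere_iff_norm] at hw
      rw [mem_ball_iff_norm] at hc
      linarith [norm_le_norm_add_norm_sub' c c₀, norm_le_norm_add_norm_sub' w c]
  exact (hasDerivAt_integral_of_dominated_loc_of_deriv_le
    (F' := fun c a => deriv (fun c => K c a) c) (ball_mem_nhds c₀ one_pos) (.of_forall hmeas)
    ((hint ‖c₀‖).mono' (hmeas c₀) (.of_forall fun a => hbound _ c₀ a le_rfl)) hmeas_deriv
    (.of_forall hderiv_le) (hint _)
    (.of_forall fun a c _ => (hdiff a c).hasDerivAt)).2.differentiableAt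

theorem eq_of_forall_eq_re {E : Type*} [NormedAddCommGroup E] [NormedSpace ℂ E] {φ : ℂ → E}
    (hφ : Differentiable ℂ φ) (hre : ∀ c, φ c = φ c.re) (c c' : ℂ) : φ c = φ c' := by
  refine is_const_of_deriv_eq_zero hφ (fun w => ?_) c c'
  have hline : HasDerivAt (fun t : ℝ => w + (t : ℂ) * Complex.I) Complex.I 0 := by
    simpa using ((Complex.ofRealCLM.hasDerivAt (x := 0)).mul_const Complex.I).const_add w
  have hcomp := HasDerivAt.scomp (0 : ℝ) (hφ _).hasDerivAt hline
  have hconst : (φ ∘ fun t : ℝ => w + (t : ℂ) * Complex.I) = fun _ => φ w := by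
    funext t
    rw [Function.comp_apply, hre, hre w]
    simp
  rw [hconst] at hcomp
  simpa using hcomp.unique (hasDerivAt_const _ _)

theorem integral_complexPoint_eq {H : EuclideanSpace ℂ (Fin d) → ℂ} (hH : Differentiable ℂ H)
    {n : ℕ} (hn : d < n)
    (hdecay : ∀ R : ℝ, (fun q : EuclideanSpace ℝ (Fin d) × EuclideanSpace ℝ (Fin d) =>
      H (complexPoint q.1 q.2)) =O[𝓟 {q | ‖q.1‖ ≤ R}] fun q => ((1 + ‖q.2‖) ^ n)⁻¹)
    (u : EuclideanSpace ℝ (Fin d)) :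
    ∫ v, H (complexPoint u v) = ∫ v, H (complexPoint 0 v) := by
  let K (c : ℂ) (v : EuclideanSpace ℝ (Fin d)) : ℂ := H (c • complexPoint u 0 + complexPoint 0 v)
  have hK (c v) : K c v = H (complexPoint (c.re • u) (v + c.im • u)) :=
    congrArg H (smul_complexPoint_add c u v)
  choose C hC using fun R => isBigO_principal.1 (hdecay R)
  have hbound (R : ℝ) (c : ℂ) (v) (hc : ‖c‖ ≤ R) : ‖K c v‖ ≤
      |C (R * ‖u‖)| * ((1 + R * ‖u‖) ^ n * ((1 + ‖v‖) ^ n)⁻¹) := by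
    have hsmul {t : ℝ} (ht : |t| ≤ ‖c‖) : ‖t • u‖ ≤ R * ‖u‖ := by
      rw [norm_smul, Real.norm_eq_abs]
      gcongr
      exact ht.trans hc
    rw [hK]
    refine (hC _ (_, _) (hsmul (Complex.abs_re_le_norm c))).trans ?_
    rw [Real.norm_of_nonneg (by positivity)]
    gcongr
    · exact le_abs_self _
    · exact inv_one_add_norm_add_pow_le (hsmul (Complex.abs_im_le_norm c)) n
  have hmeas (c : ℂ) : AEStronglyMeasurable (K c) := by
    have := hH.continuous
    exact Continuous.aestronglyMeasurable (by fun_prop)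
  have hdiff : Differentiable ℂ fun c => ∫ v, K c v :=
    differentiable_integral_of_locally_dominated hmeas
      (fun v => hH.comp ((differentiable_id.smul_const _).add_const _))
      (fun R => ((integrable_inv_one_add_norm_pow (by simpa)).const_mul _).const_mul _) hbound
  -- Moving `c` in the imaginary direction only translates the variable of integration.
  have hre (c : ℂ) : ∫ v, K c v = ∫ v, K c.re v := by
    simp only [hK, Complex.ofReal_re, Complex.ofReal_im, zero_smul, add_zero]
    exact integral_add_right_eq_self (fun v => H (complexPoint (c.re • u) v)) (c.im • u)
  simpa [hK] using eq_of_forall_eq_re hdiff hre 1 0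

/-! ### Growth conditions and slices -/

/-- The bound of order `n` on an entire function which, imposed for all `n`, characterizes the
transforms of functions of Schwartz type. -/
def HasGrowth (p : ℝ) (n : ℕ) (G : EuclideanSpace ℂ (Fin d) → ℂ) : Prop :=
  (fun q : EuclideanSpace ℝ (Fin d) × EuclideanSpace ℝ (Fin d) => G (complexPoint q.1 q.2)) =O[⊤]
    fun q => Real.exp (‖q.2‖ ^ 2 / 2) * Real.exp (‖q.1‖ ^ 2 / (2 * (p - 1))) *
      ((1 + ‖q.1‖) ^ n * (1 + ‖q.2‖) ^ n)⁻¹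

/-- The restriction of `G` to `u + iℝ^d`, with the Gaussian weight `e^{-v²/2}`. -/
def slice (G : EuclideanSpace ℂ (Fin d) → ℂ) (u v : EuclideanSpace ℝ (Fin d)) : ℂ :=
  G (complexPoint u v) * (Real.exp (-‖v‖ ^ 2 / 2) : ℂ)

theorem continuous_slice (hG : Continuous G) (u : EuclideanSpace ℝ (Fin d)) :
    Continuous (slice G u) := by
  unfold slice
  fun_prop

theorem norm_complexPoint_apply_le (x y : EuclideanSpace ℝ (Fin d)) (j : Fin d) :
    ‖complexPoint x y j‖ ≤ ‖x‖ + ‖y‖ :=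
  calc ‖complexPoint x y j‖ ≤ ‖x j‖ + ‖y j‖ := by
        simpa [complexPoint_apply] using norm_add_le (x j : ℂ) (Complex.I * (y j : ℂ))
    _ ≤ ‖x‖ + ‖y‖ := add_le_add (PiLp.norm_apply_le x j) (PiLp.norm_apply_le y j)

variable {p : ℝ} {n : ℕ}

theorem hasGrowth_iff :
    HasGrowth p n G ↔ ∃ C : ℝ, ∀ x y : EuclideanSpace ℝ (Fin d), ‖G (complexPoint x y)‖ ≤
      C * Real.exp (‖y‖ ^ 2 / 2) * Real.exp (‖x‖ ^ 2 / (2 * (p - 1))) *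
        (1 / ((1 + ‖x‖) ^ n * (1 + ‖y‖) ^ n)) := by
  rw [HasGrowth, isBigO_top]
  refine exists_congr fun C => Prod.forall.trans (forall₂_congr fun x y => ?_)
  rw [Real.norm_of_nonneg (by positivity), one_div]
  simp only [mul_assoc]

namespace HasGrowth

theorem coord_mul (hG : HasGrowth p (n + 1) G) (k : Fin d) :
    HasGrowth p n fun z => z k * G z := by
  have hcoord : (fun q : EuclideanSpace ℝ (Fin d) × EuclideanSpace ℝ (Fin d) =>
      complexPoint q.1 q.2 k) =O[⊤] fun q => (1 + ‖q.1‖) * (1 + ‖q.2‖) := by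
    refine .of_norm_le fun q => (norm_complexPoint_apply_le q.1 q.2 k).trans ?_
    nlinarith [mul_nonneg (norm_nonneg q.1) (norm_nonneg q.2)]
  refine (hcoord.mul hG).congr_right fun q => ?_
  have : 1 + ‖q.1‖ ≠ 0 := by positivity
  have : 1 + ‖q.2‖ ≠ 0 := by positivity
  field_simp
  ring

theorem slice_isBigO (hG : HasGrowth p n G) :
    (fun q : EuclideanSpace ℝ (Fin d) × EuclideanSpace ℝ (Fin d) => slice G q.1 q.2) =O[⊤]
      fun q => Real.exp (‖q.1‖ ^ 2 / (2 * (p - 1))) * ((1 + ‖q.1‖) ^ n)⁻¹ *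
        ((1 + ‖q.2‖) ^ n)⁻¹ := by
  have hweight : (fun q : EuclideanSpace ℝ (Fin d) × EuclideanSpace ℝ (Fin d) =>
      (Real.exp (-‖q.2‖ ^ 2 / 2) : ℂ)) =O[⊤] fun q => Real.exp (-‖q.2‖ ^ 2 / 2) :=
    Complex.isBigO_ofReal_left.2 (isBigO_refl _ _)
  refine (IsBigO.mul hG hweight).congr_right fun q => ?_
  have hexp : Real.exp (‖q.2‖ ^ 2 / 2) * Real.exp (-‖q.2‖ ^ 2 / 2) = 1 := by
    rw [← Real.exp_add, neg_div, add_neg_cancel, Real.exp_zero]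
  rw [mul_inv]
  linear_combination Real.exp (‖q.1‖ ^ 2 / (2 * (p - 1))) * ((1 + ‖q.1‖) ^ n)⁻¹ *
    ((1 + ‖q.2‖) ^ n)⁻¹ * hexp

theorem slice_isBigO_right (hG : HasGrowth p n G) (u : EuclideanSpace ℝ (Fin d)) :
    slice G u =O[⊤] fun v => ((1 + ‖v‖) ^ n)⁻¹ :=
  (hG.slice_isBigO.comp_tendsto (tendsto_top (f := fun v => (u, v)))).trans
    (isBigO_const_mul_self (Real.exp (‖u‖ ^ 2 / (2 * (p - 1))) * ((1 + ‖u‖) ^ n)⁻¹) _ _)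

theorem integrable_pow_mul_slice {m : ℕ} (hG : HasGrowth p (n + m) G) (hGc : Continuous G)
    (hn : d < n) (u : EuclideanSpace ℝ (Fin d)) :
    Integrable fun v => ‖v‖ ^ m * ‖slice G u v‖ := by
  have hslice := continuous_slice hGc u
  have hpow : (fun v : EuclideanSpace ℝ (Fin d) => ‖v‖ ^ m) =O[⊤] fun v => (1 + ‖v‖) ^ m := by
    refine .of_norm_le fun v => ?_
    rw [norm_pow, norm_norm]
    gcongr
    linarith
  have hbound : (fun v => ‖v‖ ^ m * ‖slice G u v‖) =O[⊤] fun v => ((1 + ‖v‖) ^ n)⁻¹ := by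
    refine (hpow.mul (hG.slice_isBigO_right u).norm_left).congr_right fun v => ?_
    have : 1 + ‖v‖ ≠ 0 := by positivity
    field_simp
    ring
  exact (hbound.mono le_top).integrable (Continuous.aestronglyMeasurable (by fun_prop))
    (integrable_inv_one_add_norm_pow (by simpa))

theorem integrable_slice (hG : HasGrowth p n G) (hGc : Continuous G) (hn : d < n)
    (u : EuclideanSpace ℝ (Fin d)) : Integrable (slice G u) :=
  ((hG.slice_isBigO_right u).mono le_top).integrable
    (continuous_slice hGc u).aestronglyMeasurable (integrable_inv_one_add_norm_pow (by simpa))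

theorem integral_norm_slice_isBigO (hG : HasGrowth p n G) (hn : d < n) :
    (fun u => ∫ v, ‖slice G u v‖) =O[⊤]
      fun u => Real.exp (‖u‖ ^ 2 / (2 * (p - 1))) * ((1 + ‖u‖) ^ n)⁻¹ := by
  obtain ⟨C, hC⟩ := isBigO_top.1 hG.slice_isBigO
  refine isBigO_top.2
    ⟨C * ∫ v : EuclideanSpace ℝ (Fin d), ((1 + ‖v‖) ^ n)⁻¹, fun u => ?_⟩
  rw [mul_right_comm, ← integral_const_mul]
  refine norm_integral_le_of_norm_le
    ((integrable_inv_one_add_norm_pow (by simpa)).const_mul _) (.of_forall fun v => ?_)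
  simpa only [norm_norm, norm_mul, norm_inv, norm_pow, mul_assoc,
    Real.norm_of_nonneg (show 0 ≤ 1 + ‖v‖ by positivity)] using hC (u, v)

end HasGrowth

/-! ### The inverse transform -/

/-- Up to the normalizing factor, `inverseKernel z x` is the reciprocal of `ρ(z - x)`. -/
def inverseKernel (z : EuclideanSpace ℂ (Fin d)) (x : EuclideanSpace ℝ (Fin d)) : ℂ :=
  Complex.exp ((∑ j, (z - complexPoint x 0) j ^ 2) / 2)

/-- The inversion formula for the Segal-Bargmann transform, as an integral over `u + iℝ^d`. -/
def inverseTransform (u : EuclideanSpace ℝ (Fin d)) (G : EuclideanSpace ℂ (Fin d) → ℂ)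
    (x : EuclideanSpace ℝ (Fin d)) : ℂ :=
  (((2 * Real.pi) ^ (-(d : ℝ) / 2) : ℝ) : ℂ) *
    ∫ v, G (complexPoint u v) * inverseKernel (complexPoint u v) x

theorem complexPoint_sub_real (u v x : EuclideanSpace ℝ (Fin d)) :
    complexPoint u v - complexPoint x 0 = complexPoint (u - x) v := by
  ext j
  simp only [PiLp.sub_apply, complexPoint_apply, PiLp.zero_apply]
  push_cast
  ring

theorem sum_complexPoint_sq (a b : EuclideanSpace ℝ (Fin d)) :
    ∑ j, complexPoint a b j ^ 2 =
      (‖a‖ ^ 2 : ℝ) - (‖b‖ ^ 2 : ℝ) + 2 * Complex.I * (inner ℝ a b : ℝ) := by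
  rw [EuclideanSpace.real_norm_sq_eq, EuclideanSpace.real_norm_sq_eq, PiLp.inner_apply]
  push_cast
  rw [Finset.mul_sum, ← Finset.sum_sub_distrib, ← Finset.sum_add_distrib]
  refine Finset.sum_congr rfl fun j _ => ?_
  simp only [complexPoint_apply, RCLike.inner_apply, conj_trivial]
  push_cast
  linear_combination (b j : ℂ) ^ 2 * Complex.I_sq

theorem inverseKernel_complexPoint (u v x : EuclideanSpace ℝ (Fin d)) :
    inverseKernel (complexPoint u v) x = Real.exp (‖x - u‖ ^ 2 / 2) * Real.exp (-‖v‖ ^ 2 / 2) *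
      Complex.exp (-(Complex.I * (inner ℝ v (x - u) : ℝ))) := by
  rw [inverseKernel, complexPoint_sub_real, sum_complexPoint_sq, Complex.ofReal_exp,
    Complex.ofReal_exp, ← Complex.exp_add, ← Complex.exp_add, ← neg_sub x u, norm_neg,
    inner_neg_left, real_inner_comm]
  congr 1
  push_cast
  ring

theorem norm_inverseKernel (u v x : EuclideanSpace ℝ (Fin d)) :
    ‖inverseKernel (complexPoint u v) x‖ =
      Real.exp (‖x - u‖ ^ 2 / 2) * Real.exp (-‖v‖ ^ 2 / 2) := by
  have hphase : (-(Complex.I * (inner ℝ v (x - u) : ℝ))).re = 0 := by simp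
  rw [inverseKernel_complexPoint, norm_mul, norm_mul, Complex.norm_exp, hphase, Real.exp_zero,
    mul_one, Complex.norm_real, Complex.norm_real, Real.norm_of_nonneg (Real.exp_nonneg _),
    Real.norm_of_nonneg (Real.exp_nonneg _)]

theorem norm_mul_inverseKernel (G : EuclideanSpace ℂ (Fin d) → ℂ)
    (u v x : EuclideanSpace ℝ (Fin d)) :
    ‖G (complexPoint u v) * inverseKernel (complexPoint u v) x‖ =
      Real.exp (‖x - u‖ ^ 2 / 2) * ‖slice G u v‖ := by
  rw [norm_mul, norm_inverseKernel, slice, norm_mul, Complex.norm_real,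
    Real.norm_of_nonneg (Real.exp_nonneg _)]
  ring

theorem differentiable_inverseKernel (x : EuclideanSpace ℝ (Fin d)) :
    Differentiable ℂ fun z => inverseKernel z x := by
  have hproj (j : Fin d) : Differentiable ℂ fun z : EuclideanSpace ℂ (Fin d) => z j :=
    (EuclideanSpace.proj (𝕜 := ℂ) j).differentiable
  unfold inverseKernel
  simp only [div_eq_mul_inv]
  exact ((Differentiable.fun_sum fun j _ =>
    ((hproj j).sub_const (complexPoint x 0 j)).pow 2).mul_const _).cexp

theorem inverseTransform_eq_fourier (u : EuclideanSpace ℝ (Fin d))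
    (G : EuclideanSpace ℂ (Fin d) → ℂ) (x : EuclideanSpace ℝ (Fin d)) :
    inverseTransform u G x = (((2 * Real.pi) ^ (-(d : ℝ) / 2) : ℝ) : ℂ) *
      ((Real.exp (‖x - u‖ ^ 2 / 2) : ℂ) * 𝓕 (slice G u) ((2 * Real.pi)⁻¹ • (x - u))) := by
  rw [inverseTransform, Real.fourier_eq']
  congr 1
  rw [← integral_const_mul]
  refine integral_congr_ae (.of_forall fun v => ?_)
  have hphase : -2 * Real.pi * inner ℝ v ((2 * Real.pi)⁻¹ • (x - u)) = -inner ℝ v (x - u) := by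
    rw [real_inner_smul_right]
    field_simp
  simp only [inverseKernel_complexPoint, slice, smul_eq_mul, hphase]
  push_cast
  ring_nf

theorem norm_inverseTransform_le (u : EuclideanSpace ℝ (Fin d))
    (G : EuclideanSpace ℂ (Fin d) → ℂ) (x : EuclideanSpace ℝ (Fin d)) :
    ‖inverseTransform u G x‖ ≤
      (2 * Real.pi) ^ (-(d : ℝ) / 2) * (Real.exp (‖x - u‖ ^ 2 / 2) * ∫ v, ‖slice G u v‖) := by
  rw [inverseTransform, norm_mul, Complex.norm_real, Real.norm_of_nonneg (by positivity),
    ← integral_const_mul]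
  simp only [← norm_mul_inverseKernel]
  gcongr
  exact norm_integral_le_integral_norm _

theorem HasGrowth.inverseTransform_eq (hG : HasGrowth p n G) (hp : 1 < p) (hGd : Differentiable ℂ G)
    (hn : d < n) (u : EuclideanSpace ℝ (Fin d)) :
    inverseTransform u G = inverseTransform 0 G := by
  funext x
  have : 0 < p - 1 := sub_pos.2 hp
  obtain ⟨C, hC⟩ := isBigO_top.1 hG.slice_isBigO
  refine congrArg _ (integral_complexPoint_eq (hGd.mul (differentiable_inverseKernel x)) hn
    (fun R => isBigO_principal.2
      ⟨Real.exp ((‖x‖ + R) ^ 2 / 2) * (|C| * Real.exp (R ^ 2 / (2 * (p - 1)))), ?_⟩) u)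
  rintro ⟨u, v⟩ (hu : ‖u‖ ≤ R)
  have hslice : ‖slice G u v‖ ≤ |C| * Real.exp (R ^ 2 / (2 * (p - 1))) * ((1 + ‖v‖) ^ n)⁻¹ :=
    calc ‖slice G u v‖
        ≤ C * (Real.exp (‖u‖ ^ 2 / (2 * (p - 1))) * ((1 + ‖u‖) ^ n)⁻¹ * ((1 + ‖v‖) ^ n)⁻¹) := by
          simpa only [norm_mul, norm_inv, norm_pow, Real.norm_eq_abs, Real.abs_exp,
            abs_of_nonneg (show 0 ≤ 1 + ‖u‖ by positivity),
            abs_of_nonneg (show 0 ≤ 1 + ‖v‖ by positivity)] using hC (u, v)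
      _ ≤ |C| * (Real.exp (R ^ 2 / (2 * (p - 1))) * 1 * ((1 + ‖v‖) ^ n)⁻¹) := by
          gcongr
          · exact le_abs_self C
          · exact inv_le_one_of_one_le₀ (one_le_pow₀ (by linarith [norm_nonneg u]))
      _ = |C| * Real.exp (R ^ 2 / (2 * (p - 1))) * ((1 + ‖v‖) ^ n)⁻¹ := by ring
  have hxu : ‖x - u‖ ≤ ‖x‖ + R := (norm_sub_le x u).trans (by gcongr)
  rw [Pi.mul_apply, norm_mul_inverseKernel, Real.norm_of_nonneg (by positivity), mul_assoc]
  gcongr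

theorem contDiff_inverseTransform (hG : ∀ n, HasGrowth p n G) (hGc : Continuous G)
    (u : EuclideanSpace ℝ (Fin d)) : ContDiff ℝ ∞ (inverseTransform u G) := by
  have hweight : ContDiff ℝ ∞ fun x => (Real.exp (‖x - u‖ ^ 2 / 2) : ℂ) :=
    Complex.ofRealCLM.contDiff.comp
      (((contDiff_id.sub contDiff_const).norm_sq ℝ).div_const 2).exp
  have hfourier : ContDiff ℝ ∞ (𝓕 (slice G u)) :=
    Real.contDiff_fourier (N := ⊤) fun m _ =>
      (hG (d + 1 + m)).integrable_pow_mul_slice hGc d.lt_succ_self u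
  rw [funext (inverseTransform_eq_fourier u G)]
  exact contDiff_const.mul (hweight.mul (hfourier.comp
    ((contDiff_id.sub contDiff_const).const_smul (2 * Real.pi)⁻¹)))

theorem hasDerivAt_sum_sub_complexPoint_sq (z : EuclideanSpace ℂ (Fin d))
    (x : EuclideanSpace ℝ (Fin d)) (k : Fin d) (t : ℝ) :
    HasDerivAt
      (fun s : ℝ => (∑ j, (z - complexPoint (x + s • EuclideanSpace.single k (1 : ℝ)) 0) j ^ 2) / 2)
      (-(z - complexPoint (x + t • EuclideanSpace.single k (1 : ℝ)) 0) k) t := by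
  have hcoord (j : Fin d) : HasDerivAt
      (fun s : ℝ => complexPoint (x + s • EuclideanSpace.single k (1 : ℝ)) 0 j)
      (Pi.single (M := fun _ => ℂ) k 1 j) t := by
    rcases eq_or_ne j k with rfl | hj
    · simpa [complexPoint_apply] using (hasDerivAt_id t).ofReal_comp.const_add (x j : ℂ)
    · simpa [complexPoint_apply, hj] using hasDerivAt_const t (x j : ℂ)
  have hsum := (HasDerivAt.fun_sum (u := Finset.univ) fun j _ =>
    ((hcoord j).const_sub (z j)).fun_pow 2).div_const 2
  refine hsum.congr_deriv ?_
  simp [Pi.single_apply]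
  ring

theorem HasGrowth.integrable_mul_inverseKernel (hG : HasGrowth p n G) (hGc : Continuous G)
    (hn : d < n) (u x : EuclideanSpace ℝ (Fin d)) :
    Integrable fun v => G (complexPoint u v) * inverseKernel (complexPoint u v) x := by
  have hkernel := (differentiable_inverseKernel x).continuous
  exact ((hG.integrable_slice hGc hn u).norm.const_mul (Real.exp (‖x - u‖ ^ 2 / 2))).mono'
    (Continuous.aestronglyMeasurable (by fun_prop))
    (.of_forall fun v => (norm_mul_inverseKernel G u v x).le)

theorem hasDerivAt_inverseKernel (z : EuclideanSpace ℂ (Fin d)) (x : EuclideanSpace ℝ (Fin d))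
    (k : Fin d) (t : ℝ) :
    HasDerivAt (fun s : ℝ => inverseKernel z (x + s • EuclideanSpace.single k (1 : ℝ)))
      (-(z - complexPoint (x + t • EuclideanSpace.single k (1 : ℝ)) 0) k *
        inverseKernel z (x + t • EuclideanSpace.single k (1 : ℝ))) t :=
  (hasDerivAt_sum_sub_complexPoint_sq z x k t).cexp.congr_deriv (mul_comm _ _)

theorem norm_mul_sub_mul_inverseKernel_le {u x : EuclideanSpace ℝ (Fin d)} {R : ℝ}
    (hR : ‖x - u‖ ≤ R) (G : EuclideanSpace ℂ (Fin d) → ℂ) (v : EuclideanSpace ℝ (Fin d))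
    (k : Fin d) :
    ‖G (complexPoint u v) * (-(complexPoint u v - complexPoint x 0) k *
        inverseKernel (complexPoint u v) x)‖ ≤
      Real.exp (R ^ 2 / 2) * (R * ‖slice G u v‖ + ‖v‖ * ‖slice G u v‖) := by
  have hcoord : ‖(complexPoint u v - complexPoint x 0) k‖ ≤ R + ‖v‖ := by
    rw [complexPoint_sub_real]
    refine (norm_complexPoint_apply_le _ _ k).trans ?_
    rw [norm_sub_rev]
    gcongr
  calc _ = ‖(complexPoint u v - complexPoint x 0) k‖ *
        (Real.exp (‖x - u‖ ^ 2 / 2) * ‖slice G u v‖) := by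
        rw [← norm_mul_inverseKernel, ← norm_mul, ← norm_neg]
        congr 1
        ring
    _ ≤ (R + ‖v‖) * (Real.exp (R ^ 2 / 2) * ‖slice G u v‖) := by
        have : 0 ≤ R + ‖v‖ := (norm_nonneg _).trans hcoord
        gcongr
    _ = _ := by ring

theorem HasGrowth.hasDerivAt_integral_mul_inverseKernel (hG : HasGrowth p (n + 1) G)
    (hGc : Continuous G) (hn : d < n) (u x : EuclideanSpace ℝ (Fin d)) (k : Fin d) :
    HasDerivAt (fun t : ℝ => ∫ v, G (complexPoint u v) *
        inverseKernel (complexPoint u v) (x + t • EuclideanSpace.single k (1 : ℝ)))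
      (∫ v, G (complexPoint u v) * (-(complexPoint u v - complexPoint x 0) k *
        inverseKernel (complexPoint u v) x)) 0 := by
  let xt (t : ℝ) := x + t • EuclideanSpace.single k (1 : ℝ)
  have hxt (t : ℝ) (ht : t ∈ ball 0 1) : ‖xt t - u‖ ≤ ‖x - u‖ + 1 :=
    calc ‖xt t - u‖ = ‖x - u + t • EuclideanSpace.single k (1 : ℝ)‖ := by
          rw [add_sub_right_comm]
      _ ≤ ‖x - u‖ + ‖t • EuclideanSpace.single k (1 : ℝ)‖ := norm_add_le _ _
      _ ≤ ‖x - u‖ + 1 := by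
          rw [mem_ball_zero_iff] at ht
          simpa [norm_smul] using ht.le
  have hint (t : ℝ) := hG.integrable_mul_inverseKernel hGc (Nat.lt_succ_of_lt hn) u (xt t)
  have hmeas : AEStronglyMeasurable fun v => G (complexPoint u v) *
      (-(complexPoint u v - complexPoint (xt 0) 0) k *
        inverseKernel (complexPoint u v) (xt 0)) := by
    have hkernel := (differentiable_inverseKernel (xt 0)).continuous
    exact Continuous.aestronglyMeasurable (by fun_prop)
  have hslice : Integrable fun v => ‖v‖ * ‖slice G u v‖ := by
    simpa only [pow_one] using hG.integrable_pow_mul_slice hGc hn u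
  have hderiv := (hasDerivAt_integral_of_dominated_loc_of_deriv_le (ball_mem_nhds (0 : ℝ) one_pos)
    (.of_forall fun t => (hint t).aestronglyMeasurable) (hint 0) hmeas
    (.of_forall fun v t ht => norm_mul_sub_mul_inverseKernel_le (hxt t ht) G v k)
    ((((hG.integrable_slice hGc (Nat.lt_succ_of_lt hn) u).norm.const_mul _).add hslice).const_mul _)
    (.of_forall fun v t _ =>
      (hasDerivAt_inverseKernel (complexPoint u v) x k t).const_mul _)).2
  simpa only [xt, zero_smul, add_zero] using hderiv

-- Differentiating the Gaussian kernel in `x` brings down the factor `x_k - z_k`.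
theorem HasGrowth.creation_inverseTransform (hG : HasGrowth p (n + 1) G) (hGc : Continuous G)
    (hn : d < n) (u : EuclideanSpace ℝ (Fin d)) (k : Fin d) :
    creation k (inverseTransform u G) = inverseTransform u fun z => z k * G z := by
  funext x
  have hGk : Continuous fun z => z k * G z := by fun_prop
  have hsplit : ∫ v, G (complexPoint u v) * (-(complexPoint u v - complexPoint x 0) k *
        inverseKernel (complexPoint u v) x) =
      x k * (∫ v, G (complexPoint u v) * inverseKernel (complexPoint u v) x) -
        ∫ v, complexPoint u v k * G (complexPoint u v) * inverseKernel (complexPoint u v) x := by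
    rw [← integral_const_mul, ← integral_sub
      ((hG.integrable_mul_inverseKernel hGc (Nat.lt_succ_of_lt hn) u x).const_mul _)
      ((hG.coord_mul k).integrable_mul_inverseKernel hGk hn u x)]
    refine integral_congr_ae (.of_forall fun v => ?_)
    simp only [PiLp.sub_apply, complexPoint_apply x, PiLp.zero_apply,
      Complex.ofReal_zero, mul_zero, add_zero]
    ring
  have hderiv : partialDeriv k (inverseTransform u G) x = _ :=
    ((hG.hasDerivAt_integral_mul_inverseKernel hGc hn u x k).const_mul
      (((2 * Real.pi) ^ (-(d : ℝ) / 2) : ℝ) : ℂ)).deriv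
  rw [creation, hderiv, hsplit, inverseTransform, inverseTransform]
  ring

/-! ### Decay relative to the Gaussian measure -/

/-- Decay of order `n` relative to `e^{x²/(2p)}`, the borderline growth for membership in
`L^p(ρ)`. -/
def HasGaussianDecay (p : ℝ) (n : ℕ) (f : EuclideanSpace ℝ (Fin d) → ℂ) : Prop :=
  f =O[⊤] fun x => Real.exp (‖x‖ ^ 2 / (2 * p)) * ((1 + ‖x‖) ^ n)⁻¹

theorem HasGaussianDecay.coord_mul (hf : HasGaussianDecay p (n + 1) f) (k : Fin d) :
    HasGaussianDecay p n fun x => x k * f x := by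
  have hcoord : (fun x : EuclideanSpace ℝ (Fin d) => (x k : ℂ)) =O[⊤] fun x => 1 + ‖x‖ := by
    refine .of_norm_le fun x => ?_
    rw [Complex.norm_real]
    linarith [PiLp.norm_apply_le x k]
  refine (hcoord.mul hf).congr_right fun x => ?_
  have : 1 + ‖x‖ ≠ 0 := by positivity
  field_simp
  ring

theorem hasGaussianDecay_monomial_mul (hf : ∀ n, HasGaussianDecay p n f) (α : Fin d → ℕ) (n : ℕ) :
    HasGaussianDecay p n fun x => monomial α x * f x := by
  induction α using multiIndex_induction generalizing n with
  | zero => simpa only [monomial_zero, Complex.ofReal_one, one_mul] using hf n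
  | add_single α k ih =>
    refine ((ih α le_rfl (n + 1)).coord_mul k).congr_left fun x => ?_
    rw [monomial_add_single]
    push_cast
    ring

theorem inv_one_add_norm_smul_pow_le {E : Type*} [SeminormedAddCommGroup E] [NormedSpace ℝ E]
    {c : ℝ} (hc0 : 0 < c) (hc1 : c ≤ 1) (x : E) (n : ℕ) :
    ((1 + ‖c • x‖) ^ n)⁻¹ ≤ (c ^ n)⁻¹ * ((1 + ‖x‖) ^ n)⁻¹ := by
  rw [← mul_inv, ← mul_pow, norm_smul, Real.norm_of_nonneg hc0.le]
  gcongr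
  linarith

theorem norm_sub_smul_sq_add {E : Type*} [SeminormedAddCommGroup E] [NormedSpace ℝ E]
    (hp : 1 < p) (x : E) :
    ‖x - ((p - 1) / p) • x‖ ^ 2 / 2 + ‖((p - 1) / p) • x‖ ^ 2 / (2 * (p - 1)) =
      ‖x‖ ^ 2 / (2 * p) := by
  have hp0 : 0 < p := one_pos.trans hp
  have : 0 < p - 1 := sub_pos.2 hp
  have hx : x - ((p - 1) / p) • x = p⁻¹ • x := by
    nth_rw 1 [← one_smul ℝ x]
    rw [← sub_smul, one_sub_div hp0.ne', sub_sub_cancel, one_div]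
  rw [hx, norm_smul, norm_smul, Real.norm_of_nonneg (by positivity),
    Real.norm_of_nonneg (by positivity)]
  field_simp
  ring

theorem HasGrowth.hasGaussianDecay_inverseTransform (hG : HasGrowth p n G) (hp : 1 < p)
    (hGd : Differentiable ℂ G) (hn : d < n) : HasGaussianDecay p n (inverseTransform 0 G) := by
  obtain ⟨C, hC⟩ := isBigO_top.1 (hG.integral_norm_slice_isBigO hn)
  let c := (p - 1) / p
  have hp0 : 0 < p := one_pos.trans hp
  have hc0 : 0 < c := div_pos (sub_pos.2 hp) hp0
  have hc1 : c ≤ 1 := div_le_one_of_le₀ (by linarith) hp0.le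
  refine isBigO_top.2 ⟨(2 * Real.pi) ^ (-(d : ℝ) / 2) * (|C| * (c ^ n)⁻¹), fun x => ?_⟩
  have hslice : ∫ v, ‖slice G (c • x) v‖ ≤ |C| * (Real.exp (‖c • x‖ ^ 2 / (2 * (p - 1))) *
      ((c ^ n)⁻¹ * ((1 + ‖x‖) ^ n)⁻¹)) := by
    refine (Real.le_norm_self _).trans ((hC (c • x)).trans ?_)
    rw [Real.norm_of_nonneg (by positivity)]
    gcongr
    · exact le_abs_self C
    · exact inv_one_add_norm_smul_pow_le hc0 hc1 x n
  -- The slice through `c x` is optimal: there the two Gaussian factors combine to `e^{x²/(2p)}`.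
  rw [← hG.inverseTransform_eq hp hGd hn (c • x), Real.norm_of_nonneg (by positivity)]
  calc ‖inverseTransform (c • x) G x‖
      ≤ (2 * Real.pi) ^ (-(d : ℝ) / 2) * (Real.exp (‖x - c • x‖ ^ 2 / 2) *
          (|C| * (Real.exp (‖c • x‖ ^ 2 / (2 * (p - 1))) *
            ((c ^ n)⁻¹ * ((1 + ‖x‖) ^ n)⁻¹)))) := by
        refine (norm_inverseTransform_le _ _ _).trans ?_
        gcongr
    _ = (2 * Real.pi) ^ (-(d : ℝ) / 2) * (|C| * (c ^ n)⁻¹) *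
          (Real.exp (‖x‖ ^ 2 / (2 * p)) * ((1 + ‖x‖) ^ n)⁻¹) := by
        rw [← norm_sub_smul_sq_add hp, Real.exp_add]
        ring

theorem HasGaussianDecay.mono {m : ℕ} (hf : HasGaussianDecay p n f) (hmn : m ≤ n) :
    HasGaussianDecay p m f := by
  refine IsBigO.trans hf (.of_norm_le fun x => ?_)
  rw [Real.norm_of_nonneg (by positivity)]
  gcongr
  linarith [norm_nonneg x]

theorem hasGaussianDecay_multiDeriv_inverseTransform (hp : 1 < p) (β : Fin d → ℕ)
    (hG : ∀ n, HasGrowth p n G) (hGd : Differentiable ℂ G) (n : ℕ) :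
    HasGaussianDecay p n (multiDeriv β (inverseTransform 0 G)) := by
  induction β using multiIndex_induction generalizing G n with
  | zero =>
    rw [multiDeriv_zero]
    exact ((hG (n + (d + 1))).hasGaussianDecay_inverseTransform hp hGd (by omega)).mono
      (Nat.le_add_right _ _)
  | add_single β k ih =>
    have hf : ContDiff ℝ ∞ (inverseTransform 0 G) := contDiff_inverseTransform hG hGd.continuous 0
    have hcreation : partialDeriv k (inverseTransform 0 G) = fun x =>
        x k * inverseTransform 0 G x - inverseTransform 0 (fun z => z k * G z) x := by
      funext x
      rw [← (hG (d + 1 + 1)).creation_inverseTransform hGd.continuous d.lt_succ_self, creation]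
      ring
    have hGk (n : ℕ) : HasGrowth p n fun z => z k * G z := (hG (n + 1)).coord_mul k
    have hGkd : Differentiable ℂ fun z => z k * G z :=
      (EuclideanSpace.proj (𝕜 := ℂ) k).differentiable.mul hGd
    rw [← multiDeriv_partialDeriv hf, hcreation, multiDeriv_sub ((contDiff_coord k).mul hf)
      (contDiff_inverseTransform hGk hGkd.continuous 0), multiDeriv_coord_mul hf]
    exact (((ih β le_rfl hG hGd (n + 1)).coord_mul k).add
      ((ih _ tsub_le_self hG hGd n).const_mul_left _)).sub (ih β le_rfl hGk hGkd n)

theorem rho_eq (x : EuclideanSpace ℝ (Fin d)) :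
    rho d x = (2 * Real.pi) ^ (-(d : ℝ) / 2) * Real.exp (-‖x‖ ^ 2 / 2) := by
  rw [rho, EuclideanSpace.real_norm_sq_eq]

theorem rho_pos (x : EuclideanSpace ℝ (Fin d)) : 0 < rho d x := by
  unfold rho
  positivity

theorem continuous_rho : Continuous (rho d) := by
  unfold rho
  fun_prop

theorem integrable_gaussianMeasure_iff {E : Type*} [NormedAddCommGroup E] [NormedSpace ℝ E]
    {φ : EuclideanSpace ℝ (Fin d) → E} :
    Integrable φ (gaussianMeasure d) ↔ Integrable fun x => rho d x • φ x := by
  rw [gaussianMeasure, integrable_withDensity_iff_integrable_smul'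
    (continuous_rho.measurable.ennreal_ofReal) (by simp)]
  simp only [ENNReal.toReal_ofReal (rho_pos _).le]

theorem integral_gaussianMeasure {E : Type*} [NormedAddCommGroup E] [NormedSpace ℝ E]
    (φ : EuclideanSpace ℝ (Fin d) → E) :
    ∫ x, φ x ∂gaussianMeasure d = ∫ x, rho d x • φ x := by
  rw [gaussianMeasure, integral_withDensity_eq_integral_toReal_smul
    (continuous_rho.measurable.ennreal_ofReal) (by simp)]
  simp only [ENNReal.toReal_ofReal (rho_pos _).le]

theorem HasGaussianDecay.memLp (hf : HasGaussianDecay p n f) (hp : 0 < p) (hfc : Continuous f)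
    (hn : d < n * p) : MemLp f (ENNReal.ofReal p) (gaussianMeasure d) := by
  rw [← integrable_norm_rpow_iff hfc.aestronglyMeasurable (by simpa using hp)
    ENNReal.ofReal_ne_top, ENNReal.toReal_ofReal hp.le, integrable_gaussianMeasure_iff]
  have hcancel (x : EuclideanSpace ℝ (Fin d)) :
      rho d x * (Real.exp (‖x‖ ^ 2 / (2 * p)) * ((1 + ‖x‖) ^ n)⁻¹) ^ p =
        (2 * Real.pi) ^ (-(d : ℝ) / 2) * (1 + ‖x‖) ^ (-(n * p)) := by
    have hpow : ((1 + ‖x‖) ^ n)⁻¹ ^ p = (1 + ‖x‖) ^ (-(n * p)) := by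
      rw [Real.inv_rpow (by positivity), ← Real.rpow_natCast_mul (by positivity),
        ← Real.rpow_neg (by positivity)]
    rw [Real.mul_rpow (by positivity) (by positivity), ← Real.exp_mul, rho_eq, hpow]
    have hexp : Real.exp (-‖x‖ ^ 2 / 2) * Real.exp (‖x‖ ^ 2 / (2 * p) * p) = 1 := by
      rw [← Real.exp_add, Real.exp_eq_one_iff]
      field_simp
      ring
    linear_combination (2 * Real.pi) ^ (-(d : ℝ) / 2) * (1 + ‖x‖) ^ (-(n * p)) * hexp
  have hbound : (fun x => rho d x • ‖f x‖ ^ p) =O[⊤]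
      fun x => (2 * Real.pi) ^ (-(d : ℝ) / 2) * (1 + ‖x‖) ^ (-(n * p)) :=
    ((isBigO_refl (rho d) ⊤).smul (hf.norm_left.rpow hp.le
      (.of_forall fun x => by positivity))).congr_right hcancel
  refine (hbound.mono le_top).integrable (Continuous.aestronglyMeasurable ?_)
    ((integrable_one_add_norm (by simpa)).const_mul _)
  exact continuous_rho.smul (hfc.norm.rpow_const fun _ => .inr hp.le)

theorem schwartzLp_inverseTransform (hp : 1 < p) (hG : ∀ n, HasGrowth p n G)
    (hGd : Differentiable ℂ G) :
    SchwartzLp (ENNReal.ofReal p) (gaussianMeasure d) (inverseTransform 0 G) where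
  contDiff := contDiff_inverseTransform hG hGd.continuous 0
  memLp_monomial_mul α β := by
    have hf := (contDiff_multiDeriv (contDiff_inverseTransform hG hGd.continuous 0) β).continuous
    have hfc : Continuous fun x => (monomial α x : ℂ) * multiDeriv β (inverseTransform 0 G) x := by
      unfold monomial
      fun_prop
    refine (hasGaussianDecay_monomial_mul (hasGaussianDecay_multiDeriv_inverseTransform hp β hG hGd)
      α (d + 1)).memLp (one_pos.trans hp) hfc ?_
    push_cast
    nlinarith [(d.cast_nonneg : (0 : ℝ) ≤ d)]

/-! ### The Segal-Bargmann transform on `L^p(ρ)` -/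

theorem integral_rho : ∫ x, rho d x = 1 := by
  have hpi : 0 < 2 * Real.pi := by positivity
  have hexp (x : EuclideanSpace ℝ (Fin d)) :
      rho d x = (2 * Real.pi) ^ (-(d : ℝ) / 2) * Real.exp (-(1 / 2) * ‖x‖ ^ 2) := by
    rw [rho_eq]
    ring_nf
  simp only [hexp]
  rw [integral_const_mul, GaussianFourier.integral_rexp_neg_mul_sq_norm one_half_pos,
    finrank_euclideanSpace_fin, div_div_eq_mul_div, div_one, mul_comm Real.pi,
    ← Real.rpow_add hpi, neg_div, neg_add_cancel, Real.rpow_zero]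

theorem integrable_rho : Integrable (rho d) :=
  integrable_of_integral_eq_one integral_rho

theorem rho_mul_exp_inner (w x : EuclideanSpace ℝ (Fin d)) :
    rho d x * Real.exp (inner ℝ w x) = Real.exp (‖w‖ ^ 2 / 2) * rho d (w - x) := by
  rw [rho_eq, rho_eq, norm_sub_sq_real, mul_assoc, ← Real.exp_add,
    mul_left_comm (Real.exp _), ← Real.exp_add]
  ring_nf

theorem rho_smul_exp_inner_rpow (u x : EuclideanSpace ℝ (Fin d)) (q : ℝ) :
    rho d x • Real.exp (inner ℝ u x) ^ q =
      Real.exp (q ^ 2 * ‖u‖ ^ 2 / 2) * rho d (q • u - x) := by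
  rw [smul_eq_mul, ← Real.exp_mul, mul_comm (inner ℝ u x), ← real_inner_smul_left,
    rho_mul_exp_inner, norm_smul, mul_pow, Real.norm_eq_abs, sq_abs]

theorem memLp_exp_inner {q : ℝ} (hq : 0 < q) (u : EuclideanSpace ℝ (Fin d)) :
    MemLp (fun x => Real.exp (inner ℝ u x)) (ENNReal.ofReal q) (gaussianMeasure d) := by
  have hc : Continuous fun x => Real.exp (inner ℝ u x) := by fun_prop
  rw [← integrable_norm_rpow_iff hc.aestronglyMeasurable (by simpa using hq)
    ENNReal.ofReal_ne_top, ENNReal.toReal_ofReal hq.le, integrable_gaussianMeasure_iff]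
  simp only [Real.norm_eq_abs, Real.abs_exp, rho_smul_exp_inner_rpow]
  exact (integrable_rho.comp_sub_left (q • u)).const_mul _

theorem integral_exp_inner_rpow (q : ℝ) (u : EuclideanSpace ℝ (Fin d)) :
    ∫ x, Real.exp (inner ℝ u x) ^ q ∂gaussianMeasure d = Real.exp (q ^ 2 * ‖u‖ ^ 2 / 2) := by
  rw [integral_gaussianMeasure]
  simp only [rho_smul_exp_inner_rpow]
  rw [integral_const_mul, integral_sub_left_eq_self (rho d), integral_rho, mul_one]

theorem norm_rhoC_complexPoint (u v : EuclideanSpace ℝ (Fin d)) :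
    ‖rhoC d (complexPoint u v)‖ = Real.exp (‖v‖ ^ 2 / 2) * rho d u := by
  have hre : (-(∑ j, complexPoint u v j ^ 2) / 2).re = ‖v‖ ^ 2 / 2 + -‖u‖ ^ 2 / 2 := by
    rw [sum_complexPoint_sq, Complex.div_ofNat_re]
    simp [-Complex.ofReal_pow]
    ring
  rw [rhoC, norm_mul, Complex.norm_exp, hre, Real.exp_add, Complex.norm_real,
    Real.norm_of_nonneg (by positivity), rho_eq]
  ring

theorem norm_rhoC_sub_mul (f : EuclideanSpace ℝ (Fin d) → ℂ) (u v x : EuclideanSpace ℝ (Fin d)) :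
    ‖rhoC d (complexPoint u v - complexPoint x 0) * f x‖ =
      Real.exp (‖v‖ ^ 2 / 2) * Real.exp (-‖u‖ ^ 2 / 2) *
        (rho d x • (‖f x‖ * Real.exp (inner ℝ u x))) := by
  have hexp : Real.exp (-‖u‖ ^ 2 / 2) * Real.exp (‖u‖ ^ 2 / 2) = 1 := by
    rw [← Real.exp_add, neg_div, neg_add_cancel, Real.exp_zero]
  rw [norm_mul, complexPoint_sub_real, norm_rhoC_complexPoint, smul_eq_mul]
  linear_combination -Real.exp (‖v‖ ^ 2 / 2) * rho d (u - x) * ‖f x‖ * hexp -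
    Real.exp (‖v‖ ^ 2 / 2) * Real.exp (-‖u‖ ^ 2 / 2) * ‖f x‖ * rho_mul_exp_inner u x

theorem integrable_norm_mul_exp_inner (hp : 1 < p)
    (hf : MemLp f (ENNReal.ofReal p) (gaussianMeasure d)) (u : EuclideanSpace ℝ (Fin d)) :
    Integrable (fun x => ‖f x‖ * Real.exp (inner ℝ u x)) (gaussianMeasure d) :=
  have hpq := Real.HolderConjugate.conjExponent hp
  have := hpq.ennrealOfReal
  hf.norm.integrable_mul (memLp_exp_inner hpq.symm.pos u)

theorem integrable_rhoC_mul (hp : 1 < p)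
    (hf : MemLp f (ENNReal.ofReal p) (gaussianMeasure d)) (z : EuclideanSpace ℂ (Fin d)) :
    Integrable fun x => rhoC d (z - complexPoint x 0) * f x := by
  obtain ⟨u, v, rfl⟩ := exists_complexPoint_eq z
  have hkernel : Continuous fun x => rhoC d (complexPoint u v - complexPoint x 0) := by
    unfold rhoC
    fun_prop
  have hf_meas : AEStronglyMeasurable f :=
    hf.aestronglyMeasurable.mono_ac (withDensity_absolutelyContinuous'
      continuous_rho.measurable.ennreal_ofReal.aemeasurable
      (.of_forall fun x => (ENNReal.ofReal_pos.2 (rho_pos x)).ne'))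
  exact ((integrable_gaussianMeasure_iff.1 (integrable_norm_mul_exp_inner hp hf u)).const_mul
    _).mono' (hkernel.aestronglyMeasurable.mul hf_meas)
      (.of_forall fun x => (norm_rhoC_sub_mul f u v x).le)

theorem integral_norm_mul_exp_inner_le (hp : 1 < p)
    (hf : MemLp f (ENNReal.ofReal p) (gaussianMeasure d)) (u : EuclideanSpace ℝ (Fin d)) :
    ∫ x, rho d x • (‖f x‖ * Real.exp (inner ℝ u x)) ≤
      (∫ x, ‖f x‖ ^ p ∂gaussianMeasure d) ^ (1 / p) *
        Real.exp (p.conjExponent * ‖u‖ ^ 2 / 2) := by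
  have hpq := Real.HolderConjugate.conjExponent hp
  have holder := integral_mul_le_Lp_mul_Lq_of_nonneg hpq (.of_forall fun x => norm_nonneg (f x))
    (.of_forall fun x => (Real.exp_pos (inner ℝ u x)).le) hf.norm
    (memLp_exp_inner hpq.symm.pos u)
  rw [integral_gaussianMeasure, integral_exp_inner_rpow, ← Real.exp_mul] at holder
  refine holder.trans_eq ?_
  have := hpq.symm.ne_zero
  congr 2
  field_simp

theorem hasGrowth_transform (hp : 1 < p) (hf : MemLp f (ENNReal.ofReal p) (gaussianMeasure d)) :
    HasGrowth p 0 (transform f) := by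
  let N := (∫ x, ‖f x‖ ^ p ∂gaussianMeasure d) ^ (1 / p)
  refine hasGrowth_iff.2 ⟨N, fun u v => ?_⟩
  have hexp : Real.exp (-‖u‖ ^ 2 / 2) * Real.exp (p.conjExponent * ‖u‖ ^ 2 / 2) =
      Real.exp (‖u‖ ^ 2 / (2 * (p - 1))) := by
    have : p - 1 ≠ 0 := (sub_pos.2 hp).ne'
    rw [← Real.exp_add, Real.conjExponent]
    congr 1
    field_simp
    ring
  calc ‖transform f (complexPoint u v)‖
      ≤ ∫ x, ‖rhoC d (complexPoint u v - complexPoint x 0) * f x‖ :=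
        norm_integral_le_integral_norm _
    _ = Real.exp (‖v‖ ^ 2 / 2) * Real.exp (-‖u‖ ^ 2 / 2) *
          ∫ x, rho d x • (‖f x‖ * Real.exp (inner ℝ u x)) := by
        simp only [norm_rhoC_sub_mul, integral_const_mul]
    _ ≤ Real.exp (‖v‖ ^ 2 / 2) * Real.exp (-‖u‖ ^ 2 / 2) *
          (N * Real.exp (p.conjExponent * ‖u‖ ^ 2 / 2)) := by
        gcongr
        exact integral_norm_mul_exp_inner_le hp hf u
    _ = N * Real.exp (‖v‖ ^ 2 / 2) * Real.exp (‖u‖ ^ 2 / (2 * (p - 1))) *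
          (1 / ((1 + ‖u‖) ^ 0 * (1 + ‖v‖) ^ 0)) := by
        rw [← hexp]
        ring

theorem hasLineDerivAt_rhoC_sub (z : EuclideanSpace ℂ (Fin d)) (x : EuclideanSpace ℝ (Fin d))
    (k : Fin d) :
    HasLineDerivAt ℝ (fun x => rhoC d (z - complexPoint x 0))
      ((z k - x k) * rhoC d (z - complexPoint x 0)) x (EuclideanSpace.single k 1) := by
  have hexp := ((hasDerivAt_sum_sub_complexPoint_sq z x k 0).fun_neg.cexp).const_mul
    (((2 * Real.pi) ^ (-(d : ℝ) / 2) : ℝ) : ℂ)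
  simp only [zero_smul, add_zero, neg_neg, ← neg_div] at hexp
  refine hexp.congr_deriv ?_
  rw [rhoC, PiLp.sub_apply, complexPoint_apply, PiLp.zero_apply, Complex.ofReal_zero, mul_zero,
    add_zero]
  ring

theorem transform_creation (hp : 1 < p)
    (hf : SchwartzLp (ENNReal.ofReal p) (gaussianMeasure d) f) (k : Fin d)
    (z : EuclideanSpace ℂ (Fin d)) : transform (creation k f) z = z k * transform f z := by
  have hint {h : EuclideanSpace ℝ (Fin d) → ℂ}
      (hh : SchwartzLp (ENNReal.ofReal p) (gaussianMeasure d) h) :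
      Integrable fun x => rhoC d (z - complexPoint x 0) * h x := integrable_rhoC_mul hp hh.memLp z
  have hsplit (x : EuclideanSpace ℝ (Fin d)) : (z k - x k) * rhoC d (z - complexPoint x 0) * f x =
      z k * (rhoC d (z - complexPoint x 0) * f x) -
        rhoC d (z - complexPoint x 0) * ((x k : ℂ) * f x) := by ring
  have hparts : ∫ x, rhoC d (z - complexPoint x 0) * partialDeriv k f x =
      -∫ x, (z k - x k) * rhoC d (z - complexPoint x 0) * f x := by
    refine integral_bilinear_hasLineDerivAt_right_eq_neg_left_of_integrable
      (B := ContinuousLinearMap.mul ℝ ℂ) ?_ (hint (hf.partialDeriv k)) (hint hf)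
      (fun x _ => hasLineDerivAt_rhoC_sub z x k) fun x _ =>
        (hf.contDiff.differentiable (by simp) x).lineDifferentiableAt.hasLineDerivAt
    simp only [ContinuousLinearMap.mul_apply', hsplit]
    exact ((hint hf).const_mul _).sub (hint (hf.coord_mul k))
  simp only [hsplit] at hparts
  rw [integral_sub ((hint hf).const_mul _) (hint (hf.coord_mul k)), integral_const_mul] at hparts
  simp only [transform, creation, mul_sub]
  rw [integral_sub (hint (hf.coord_mul k)) (hint (hf.partialDeriv k)), hparts]
  ring

/-! ### Inversion -/

theorem rhoC_mul_inverseTransform (G : EuclideanSpace ℂ (Fin d) → ℂ)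
    (u s x : EuclideanSpace ℝ (Fin d)) :
    rhoC d (complexPoint u s - complexPoint x 0) * inverseTransform u G x =
      (((2 * Real.pi) ^ (-(d : ℝ) / 2) : ℝ) : ℂ) ^ 2 * Real.exp (‖s‖ ^ 2 / 2) *
        (Complex.exp ((2 * Real.pi * inner ℝ ((2 * Real.pi)⁻¹ • (x - u)) s : ℝ) * Complex.I) •
          𝓕 (slice G u) ((2 * Real.pi)⁻¹ • (x - u))) := by
  have hphase : 2 * Real.pi * inner ℝ ((2 * Real.pi)⁻¹ • (x - u)) s = inner ℝ s (x - u) := by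
    rw [real_inner_smul_left, mul_inv_cancel_left₀ Real.two_pi_pos.ne', real_inner_comm]
  have hkernel : rhoC d (complexPoint u s - complexPoint x 0) * Real.exp (‖x - u‖ ^ 2 / 2) =
      (((2 * Real.pi) ^ (-(d : ℝ) / 2) : ℝ) : ℂ) * (Real.exp (‖s‖ ^ 2 / 2) *
        Complex.exp ((inner ℝ s (x - u) : ℝ) * Complex.I)) := by
    rw [rhoC, complexPoint_sub_real, sum_complexPoint_sq, mul_assoc, Complex.ofReal_exp,
      Complex.ofReal_exp, ← Complex.exp_add, ← Complex.exp_add, ← neg_sub x u, norm_neg,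
      inner_neg_left, real_inner_comm s]
    congr 2
    push_cast
    ring
  rw [inverseTransform_eq_fourier, hphase, smul_eq_mul]
  linear_combination (((2 * Real.pi) ^ (-(d : ℝ) / 2) : ℝ) : ℂ) *
    𝓕 (slice G u) ((2 * Real.pi)⁻¹ • (x - u)) * hkernel

theorem integrable_fourier_slice (hp : 1 < p) {u : EuclideanSpace ℝ (Fin d)}
    (hG : MemLp (inverseTransform u G) (ENNReal.ofReal p) (gaussianMeasure d)) :
    Integrable (𝓕 (slice G u)) := by
  have hscaled := integrable_rhoC_mul hp hG (complexPoint u 0)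
  simp only [rhoC_mul_inverseTransform, inner_zero_right, mul_zero, Complex.ofReal_zero, zero_mul,
    Complex.exp_zero, one_smul] at hscaled
  rw [integrable_const_mul_iff (by simp [Real.rpow_eq_zero_iff_of_nonneg Real.two_pi_pos.le,
    Real.pi_ne_zero])] at hscaled
  rw [← integrable_comp_smul_iff volume _ (inv_ne_zero Real.two_pi_pos.ne')]
  simpa using hscaled.comp_add_right u

theorem normalization_sq_mul_pow :
    ((2 * Real.pi) ^ (-(d : ℝ) / 2)) ^ 2 * (2 * Real.pi) ^ d = 1 := by
  rw [← Real.rpow_mul_natCast Real.two_pi_pos.le, ← Real.rpow_natCast (2 * Real.pi) d,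
    ← Real.rpow_add Real.two_pi_pos, ← Real.rpow_zero (2 * Real.pi)]
  congr 1
  push_cast
  ring

theorem transform_inverseTransform_complexPoint (hp : 1 < p) {u : EuclideanSpace ℝ (Fin d)}
    (hG : MemLp (inverseTransform u G) (ENNReal.ofReal p) (gaussianMeasure d))
    (hGc : Continuous G) (hslice : Integrable (slice G u)) (s : EuclideanSpace ℝ (Fin d)) :
    transform (inverseTransform u G) (complexPoint u s) = G (complexPoint u s) := by
  let Ψ (y : EuclideanSpace ℝ (Fin d)) : ℂ :=
    Complex.exp ((2 * Real.pi * inner ℝ y s : ℝ) * Complex.I) • 𝓕 (slice G u) y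
  have hinv : ∫ y, Ψ y = slice G u s := by
    rw [← hslice.fourierInv_fourier_eq (integrable_fourier_slice hp hG)
      (continuous_slice hGc u).continuousAt, Real.fourierInv_eq']
  have hscale : ∫ x, Ψ ((2 * Real.pi)⁻¹ • (x - u)) = (2 * Real.pi) ^ d • slice G u s := by
    rw [integral_sub_right_eq_self (fun x => Ψ ((2 * Real.pi)⁻¹ • x)) u,
      Measure.integral_comp_inv_smul_of_nonneg volume Ψ Real.two_pi_pos.le, hinv,
      finrank_euclideanSpace_fin]
  have hexp : (Real.exp (‖s‖ ^ 2 / 2) : ℂ) * Real.exp (-‖s‖ ^ 2 / 2) = 1 := by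
    rw [← Complex.ofReal_mul, ← Real.exp_add, neg_div, add_neg_cancel, Real.exp_zero,
      Complex.ofReal_one]
  have hnorm := congrArg Complex.ofReal (normalization_sq_mul_pow (d := d))
  push_cast at hnorm
  simp only [transform, rhoC_mul_inverseTransform]
  rw [integral_const_mul, hscale, slice, Complex.real_smul]
  push_cast at hexp ⊢
  linear_combination G (complexPoint u s) * (hnorm +
    (((2 * Real.pi) ^ (-(d : ℝ) / 2) : ℝ) : ℂ) ^ 2 * (2 * Real.pi) ^ d * hexp)

theorem transform_inverseTransform (hp : 1 < p) (hG : ∀ n, HasGrowth p n G)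
    (hGd : Differentiable ℂ G) : transform (inverseTransform 0 G) = G := by
  funext z
  obtain ⟨u, s, rfl⟩ := exists_complexPoint_eq z
  have hshift := (hG (d + 1)).inverseTransform_eq hp hGd d.lt_succ_self u
  rw [← hshift]
  exact transform_inverseTransform_complexPoint hp
    (hshift ▸ (schwartzLp_inverseTransform hp hG hGd).memLp) hGd.continuous
    ((hG (d + 1)).integrable_slice hGd.continuous d.lt_succ_self u) s

/-! ### Bootstrapping the growth of a transform -/

theorem isBigO_one_add_sum_norm_pow_mul {ι κ X 𝕜 : Type*} [Fintype κ] [NormedField 𝕜]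
    {P : ι → X → 𝕜} {c : κ → X → 𝕜} {w : X → ℝ} {l : Filter X} (hbase : ∀ i, P i =O[l] w)
    (hmul : ∀ i j, ∃ i', ∀ z, P i' z = c j z * P i z) (n : ℕ) (i : ι) :
    (fun z => (1 + ∑ j, ‖c j z‖) ^ n * ‖P i z‖) =O[l] w := by
  induction n generalizing i with
  | zero => simpa only [pow_zero, one_mul] using (hbase i).norm_left
  | succ n ih =>
    choose i' hi' using hmul i
    refine ((ih i).add (IsBigO.fun_sum fun j (_ : j ∈ Finset.univ) => ih (i' j))).congr_left
      fun z => ?_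
    simp only [hi', norm_mul, ← Finset.mul_sum, ← Finset.sum_mul]
    ring

theorem norm_le_sum_abs (x : EuclideanSpace ℝ (Fin d)) : ‖x‖ ≤ ∑ j, |x j| := by
  refine le_of_sq_le_sq ?_ (Finset.sum_nonneg fun j _ => abs_nonneg _)
  rw [EuclideanSpace.real_norm_sq_eq]
  simpa using Finset.sum_sq_le_sq_sum_of_nonneg (s := Finset.univ) (f := fun j => |x j|)
    fun j _ => abs_nonneg _

theorem one_add_norm_mul_one_add_norm_le (x y : EuclideanSpace ℝ (Fin d)) :
    (1 + ‖x‖) * (1 + ‖y‖) ≤ (1 + ∑ j, ‖complexPoint x y j‖) ^ 2 := by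
  have hx : ‖x‖ ≤ ∑ j, ‖complexPoint x y j‖ := (norm_le_sum_abs x).trans <|
    Finset.sum_le_sum fun j _ => by
      simpa [complexPoint_apply] using Complex.abs_re_le_norm (complexPoint x y j)
  have hy : ‖y‖ ≤ ∑ j, ‖complexPoint x y j‖ := (norm_le_sum_abs y).trans <|
    Finset.sum_le_sum fun j _ => by
      simpa [complexPoint_apply] using Complex.abs_im_le_norm (complexPoint x y j)
  rw [sq]
  gcongr

theorem hasGrowth_of_forall_isBigO
    (hG : (fun q : EuclideanSpace ℝ (Fin d) × EuclideanSpace ℝ (Fin d) =>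
      (1 + ∑ j, ‖complexPoint q.1 q.2 j‖) ^ (2 * n) * ‖G (complexPoint q.1 q.2)‖) =O[⊤]
        fun q => Real.exp (‖q.2‖ ^ 2 / 2) * Real.exp (‖q.1‖ ^ 2 / (2 * (p - 1)))) :
    HasGrowth p n G := by
  obtain ⟨C, hC⟩ := isBigO_top.1 hG
  refine hasGrowth_iff.2 ⟨C, fun x y => ?_⟩
  have hxy := hC (x, y)
  rw [Real.norm_of_nonneg (by positivity), Real.norm_of_nonneg (by positivity)] at hxy
  rw [mul_one_div, le_div_iff₀ (by positivity), ← mul_pow, mul_assoc C, mul_comm]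
  refine le_trans ?_ hxy
  rw [pow_mul]
  gcongr
  exact one_add_norm_mul_one_add_norm_le x y

theorem SchwartzLp.hasGrowth_transform (hp : 1 < p)
    (hf : SchwartzLp (ENNReal.ofReal p) (gaussianMeasure d) f) (n : ℕ) :
    HasGrowth p n (transform f) := by
  have hbase (g : {g // SchwartzLp (ENNReal.ofReal p) (gaussianMeasure d) g}) :
      (fun q : EuclideanSpace ℝ (Fin d) × EuclideanSpace ℝ (Fin d) =>
        transform g.1 (complexPoint q.1 q.2)) =O[⊤]
          fun q => Real.exp (‖q.2‖ ^ 2 / 2) * Real.exp (‖q.1‖ ^ 2 / (2 * (p - 1))) := by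
    simpa only [HasGrowth, pow_zero, mul_one, inv_one] using
      SegalBargmann.hasGrowth_transform hp g.2.memLp
  exact hasGrowth_of_forall_isBigO (isBigO_one_add_sum_norm_pow_mul hbase
    (c := fun j q => complexPoint q.1 q.2 j)
    (fun g j => ⟨⟨_, g.2.creation j⟩, fun q => transform_creation hp g.2 j _⟩) (2 * n) ⟨f, hf⟩)

end SegalBargmann

end

theorem mainTheorem3 (d : ℕ) (p : ℝ) (hp : 1 < p)
    (F : EuclideanSpace ℂ (Fin d) → ℂ) (hF : Differentiable ℂ F) :
    (∀ n : ℕ, ∃ C : ℝ, ∀ x y : EuclideanSpace ℝ (Fin d),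
      ‖F (SegalBargmann.complexPoint x y)‖ ≤
        C * Real.exp (‖y‖ ^ 2 / 2) * Real.exp (‖x‖ ^ 2 / (2 * (p - 1))) *
          (1 / ((1 + ‖x‖) ^ n * (1 + ‖y‖) ^ n))) ↔
    (∃ f : EuclideanSpace ℝ (Fin d) → ℂ,
      MemLp f (ENNReal.ofReal p) (SegalBargmann.gaussianMeasure d) ∧
      SegalBargmann.transform f = F ∧
      ContDiff ℝ ∞ f ∧
      ∀ α β : Fin d → ℕ,
        MemLp (fun x => (SegalBargmann.monomial α x : ℂ) * SegalBargmann.multiDeriv β f x)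
          (ENNReal.ofReal p) (SegalBargmann.gaussianMeasure d)) := by
  constructor
  · intro hbound
    have hgrowth (n : ℕ) : SegalBargmann.HasGrowth p n F :=
      SegalBargmann.hasGrowth_iff.2 (hbound n)
    have hf := SegalBargmann.schwartzLp_inverseTransform hp hgrowth hF
    exact ⟨SegalBargmann.inverseTransform 0 F, hf.memLp,
      SegalBargmann.transform_inverseTransform hp hgrowth hF, hf.contDiff, hf.memLp_monomial_mul⟩
  · rintro ⟨f, -, rfl, hf_contDiff, hf_memLp⟩ n
    have hf : SegalBargmann.SchwartzLp (ENNReal.ofReal p) (SegalBargmann.gaussianMeasure d) f :=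
      ⟨hf_contDiff, hf_memLp⟩
    exact SegalBargmann.hasGrowth_iff.1 (hf.hasGrowth_transform hp n)
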